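/- **Theorem (K-means separability probability, isotropic-noise model).** Let $\mathcal F=\{\mu_1,\dots,\mu_L\}$, $L\ge 2$, be $T\times N_t$ complex matrices with orthonormal columns whose column spaces are pairwise different points of the Grassmannian $\mathcal G$ of $N_t$-dimensional subspaces of $\mathbb C^T$. For subspaces $U,V$ of $\mathbb C^T$ with orthogonal projections $P_U,P_V$ let $d_p(U,V)=\sqrt{N_t-\mathrm{tr}(P_UP_V)}$ (the Procrustes distance), let $d_{\min}=\min_{\ell\ne m}d_p(\mu_\ell,\mu_m)$ (a matrix stands for its column space), and let $\mathcal V(\mu_\ell)=\{U\in\mathcal G: d_p(U,\mu_\ell)<d_p(U,\mu_m)\ \forall m\ne\ell\}$ be the Voronoi cells. Let the transmitted symbol $X$ be a random element of $\mathcal F$ which takes every value with positive probability, and let $W$ be a $T\times N_t$ matrix, independent of $X$, with i.i.d. $\mathcal{CN}(0,1)$ entries ($\mathbb E|W_{ij}|^2=1$). Fix $\bar\lambda>0$ (standing for the mean of a typical singular value of the channel) and, for the signal-to-noise ratio $\rho>0$, let $$\widetilde\Upsilon_\rho=\mathrm{span}\Big(X+\tfrac1{\bar\lambda}\sqrt{\tfrac{N_t}{\rho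 T}}\,W\Big)$$ be the received symbol of the isotropic-noise approximation. For a received symbol $\Upsilon$ the separability probability is $p_{\rm sep}(\Upsilon)=\frac1L\sum_{\ell=1}^L\Pr(\Upsilon\in\mathcal V(\mu_\ell)\mid X=\mu_\ell)$. Put $D=2N_t(T-N_t)$, $c=T\bar\lambda^2d_{\min}^2/(8N_t)$, $G_m(\rho)=\sum_{m=0}^{D/2-1}\frac{(T\bar\lambda^2d_{\min}^2)^m}{m!\,(8N_t)^m}\rho^m$ (a polynomial in $\rho$), $\gamma(a,x)=\int_0^xt^{a-1}e^{-t}\,dt$, and let $N\ge1$ be the number of symbols in the data set. 1. For all sufficiently large $\rho$, $$p_{\rm sep}(\Upsilon_\rho)\ \ge\ B_N(\rho):=\left[\frac{1}{\Gamma(D/2)}\,\gamma\!\left(\frac D2,\frac{\rho T\bar\lambda^2d_{\min}^2}{8N_t}\right)\right]^N,$$ for $\Upsilon_\rho=\widetilde\Upsilon_\rho$, and more generally for every family of received symbols $\Upsilon_\rho$ ($\rho>0$) that take values in $\mathcal G$ almost surely and for which, given $X$, the distance $d_p(\Upsilon_\rho,X)$ has the same distribution as $d_p(\widetilde\Upsilon_\rho,X)$.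 2. As $\rho\to\infty$, $$B_N(\rho)=1-N\,e^{-c\rho}\,G_m(\rho)+O\big((e^{-c\rho}G_m(\rho))^2\big);$$ in particular, if $c>1$, the remainder is $O(e^{-2\rho})$. -/

import Mathlib

open MeasureTheory ProbabilityTheory Filter Asymptotics Module
open scoped Topology NNReal Matrix

namespace GrassmannKMeans

/-- The signal space `ℂ^T` with its Hermitian inner product. -/
abbrev SignalSpace (T : ℕ) : Type := EuclideanSpace ℂ (Fin T)

/-- The Grassmannian of `k`-dimensional linear subspaces of `ℂ^T`. -/
def grassmannian (T k : ℕ) : Set (Submodule ℂ (SignalSpace T)) :=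
  {U | finrank ℂ U = k}

/-- The column space of a `T × k` complex matrix. -/
def colSpan {T k : ℕ} (A : Matrix (Fin T) (Fin k) ℂ) : Submodule ℂ (SignalSpace T) :=
  Submodule.span ℂ (Set.range fun j : Fin k => WithLp.toLp 2 fun i : Fin T => A i j)

/-- The Procrustes distance, `d_p(U, V)² = k - tr (P_U P_V)`, where `P_U` and `P_V` are the
orthogonal projections onto the `k`-dimensional subspaces `U` and `V` (if `U` is the column space
of a matrix `Υ` with orthonormal columns, then `P_U = Υ Υᴴ`). -/
noncomputable def procrustesDist {T : ℕ} (k : ℕ) (U V : Submodule ℂ (SignalSpace T)) : ℝ :=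
  Real.sqrt ((k : ℝ) -
    (LinearMap.trace ℂ (SignalSpace T)
      ((U.starProjection : SignalSpace T →ₗ[ℂ] SignalSpace T) ∘ₗ
        (V.starProjection : SignalSpace T →ₗ[ℂ] SignalSpace T))).re)

/-- The minimum pairwise Procrustes distance of a codebook `μ_1, …, μ_L` (a minimum over a
nonempty finite set as soon as `L ≥ 2`). -/
noncomputable def minDist {T k L : ℕ} (μ : Fin L → Matrix (Fin T) (Fin k) ℂ) : ℝ :=
  sInf {d : ℝ | ∃ l m : Fin L, l ≠ m ∧ d = procrustesDist k (colSpan (μ l)) (colSpan (μ m))}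

/-- The Voronoi cell of the `l`-th codeword in the Grassmannian. -/
def voronoiCell {T k L : ℕ} (μ : Fin L → Matrix (Fin T) (Fin k) ℂ) (l : Fin L) :
    Set (Submodule ℂ (SignalSpace T)) :=
  {U | U ∈ grassmannian T k ∧ ∀ m : Fin L, m ≠ l →
    procrustesDist k U (colSpan (μ l)) < procrustesDist k U (colSpan (μ m))}

/-- The law `CN(0, 1)` of a circularly symmetric complex Gaussian variable `w` with
`E |w|² = 1`: real and imaginary part are independent `N(0, 1/2)`. -/
noncomputable def stdComplexGaussian : Measure ℂ :=
  ((gaussianReal 0 (1 / 2 : ℝ≥0)).prod (gaussianReal 0 (1 / 2 : ℝ≥0))).map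
    fun p : ℝ × ℝ => (⟨p.1, p.2⟩ : ℂ)

/-- The received Grassmann symbol under the isotropic-noise approximation, when the codeword `X`
is transmitted: the column space of `X + (1 / lam) √(k / (ρ T)) W`, with `k` transmit antennas,
symbol duration `T`, signal-to-noise ratio `ρ`, noise matrix `W`, and `lam` in the place of each
of the singular values of the channel matrix. -/
noncomputable def receivedSymbol {T k : ℕ} (lam ρ : ℝ) (X W : Matrix (Fin T) (Fin k) ℂ) :
    Submodule ℂ (SignalSpace T) :=
  colSpan (X + (((1 / lam) * Real.sqrt ((k : ℝ) / (ρ * (T : ℝ))) : ℝ) : ℂ) • W)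

/-- The separability probability `(1 / L) ∑_l Pr (Υ ∈ V(μ_l) | X = μ_l)`, where the transmitted
symbol is `X = μ_s` with random index `s`, and `Υ` is the received symbol. -/
noncomputable def sepProb {Ω : Type*} [MeasurableSpace Ω] (P : Measure Ω) {T k L : ℕ}
    (μ : Fin L → Matrix (Fin T) (Fin k) ℂ) (s : Ω → Fin L)
    (Υ : Ω → Submodule ℂ (SignalSpace T)) : ℝ :=
  (1 / (L : ℝ)) * ∑ l : Fin L, (ProbabilityTheory.cond P (s ⁻¹' {l})).real
    {ω | Υ ω ∈ voronoiCell μ l}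

/-- Given the transmitted codeword, the distances of `Υ` and of `Υ'` from that codeword have the
same distribution. -/
def SameDistanceLaw {Ω : Type*} [MeasurableSpace Ω] (P : Measure Ω) {T k L : ℕ}
    (μ : Fin L → Matrix (Fin T) (Fin k) ℂ) (s : Ω → Fin L)
    (Υ Υ' : Ω → Submodule ℂ (SignalSpace T)) : Prop :=
  ∀ (l : Fin L) (r : ℝ),
    ProbabilityTheory.cond P (s ⁻¹' {l}) {ω | procrustesDist k (Υ ω) (colSpan (μ l)) ≤ r} =
      ProbabilityTheory.cond P (s ⁻¹' {l}) {ω | procrustesDist k (Υ' ω) (colSpan (μ l)) ≤ r}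

/-- The lower incomplete Gamma function `γ(a, x) = ∫_0^x t^(a-1) e^(-t) dt`. -/
noncomputable def lowerGamma (a x : ℝ) : ℝ :=
  ∫ t in (0 : ℝ)..x, t ^ (a - 1) * Real.exp (-t)

/-- The real dimension `D = 2 k (T - k)` of the Grassmannian. -/
def grassDim (T k : ℕ) : ℕ := 2 * k * (T - k)

/-- The exponential rate `c = T lam² d² / (8 k)`. -/
noncomputable def rate (T k : ℕ) (lam d : ℝ) : ℝ :=
  (T : ℝ) * lam ^ 2 * d ^ 2 / (8 * (k : ℝ))

/-- The lower bound `[γ(D/2, ρ T lam² d² / (8 k)) / Γ(D/2)]^N`. -/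
noncomputable def sepBound (T k N : ℕ) (lam d ρ : ℝ) : ℝ :=
  (1 / Real.Gamma ((grassDim T k : ℝ) / 2) *
    lowerGamma ((grassDim T k : ℝ) / 2) (ρ * (T : ℝ) * lam ^ 2 * d ^ 2 / (8 * (k : ℝ)))) ^ N

/-- The polynomial `G_m(ρ) = ∑_{m=0}^{D/2-1} (T lam² d²)^m / (m! (8 k)^m) ρ^m`. -/
noncomputable def polyG (T k : ℕ) (lam d : ℝ) : Polynomial ℝ :=
  ∑ m ∈ Finset.range (grassDim T k / 2),
    Polynomial.C (((T : ℝ) * lam ^ 2 * d ^ 2) ^ m / ((m.factorial : ℝ) * (8 * (k : ℝ)) ^ m)) *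
      Polynomial.X ^ m

/-- The difference between the lower bound and its expansion `1 - N e^(-c ρ) G_m(ρ)`. -/
noncomputable def expansionError (T k N : ℕ) (lam d ρ : ℝ) : ℝ :=
  sepBound T k N lam d ρ -
    (1 - (N : ℝ) * Real.exp (-(ρ * (T : ℝ) * lam ^ 2 * d ^ 2 / (8 * (k : ℝ)))) *
      (polyG T k lam d).eval ρ)

end GrassmannKMeans

/-! The bound in part 1 is far from tight in its exponent, and the proof lives off this slack.
Through projection matrices `procrustesDist` is a multiple of the Frobenius distance, so the
triangle inequality puts the open ball of radius d_min/2 about a codeword inside its Voronoi cell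
(`mem_voronoiCell_of_lt`). Projecting the columns of X onto the received subspace gives d_p² ≤
ε²‖W‖² with ε² = k/(lam² ρ T) (`procrustesDist_receivedSymbol_sq_le`). As d_min²/ε² = 8cρ, leaving
the cell forces ‖W‖² ≥ 2cρ; a Chernoff bound (`noiseLaw_tail_le`) can give any exponential rate
below 2c, in particular one above c.

On the other side, integer D/2 turns the incomplete Gamma function into a truncated exponential
series, so the bound is (1 - u)^N with u = e^(-cρ) G_m(ρ) (`sepBound_eq_pow`). Since G_m ≥ 1 and N ≥
1, it is at most 1 - e^(-cρ), which the Chernoff bound eventually beats. Part 2 is the binomial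
expansion of (1 - u)^N with u in [0, 1]. -/

namespace GrassmannKMeans

/-! ### Geometry of the Procrustes distance and Voronoi cells -/

section Geometry

variable {T k : ℕ}

/-- The matrix of the orthogonal projection onto `U`, as a vector of columns whose norm is the
Frobenius norm. -/
noncomputable def projColumns (U : Submodule ℂ (SignalSpace T)) :
    PiLp 2 (fun _ : Fin T => SignalSpace T) :=
  WithLp.toLp 2 fun i => U.starProjection (EuclideanSpace.basisFun (Fin T) ℂ i)

lemma trace_starProjection_comp (U V : Submodule ℂ (SignalSpace T)) :
    LinearMap.trace ℂ (SignalSpace T)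
      ((U.starProjection : SignalSpace T →ₗ[ℂ] SignalSpace T) ∘ₗ
        (V.starProjection : SignalSpace T →ₗ[ℂ] SignalSpace T)) =
      inner ℂ (projColumns U) (projColumns V) := by
  rw [LinearMap.trace_eq_sum_inner _ (EuclideanSpace.basisFun (Fin T) ℂ), PiLp.inner_apply]
  refine Finset.sum_congr rfl fun i _ => ?_
  simp only [projColumns, LinearMap.comp_apply, ContinuousLinearMap.coe_coe]
  exact (Submodule.inner_starProjection_left_eq_right _ _ _).symm

lemma norm_projColumns_sq (U : Submodule ℂ (SignalSpace T)) :
    ‖projColumns U‖ ^ 2 = finrank ℂ U := by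
  have h1 := trace_starProjection_comp U U
  have h2 : (U.starProjection : SignalSpace T →ₗ[ℂ] SignalSpace T) ∘ₗ
      (U.starProjection : SignalSpace T →ₗ[ℂ] SignalSpace T) =
      (U.starProjection : SignalSpace T →ₗ[ℂ] SignalSpace T) := by
    ext1 x
    exact Submodule.starProjection_eq_self_iff.2 (Submodule.starProjection_apply_mem _ _)
  have h3 : LinearMap.IsProj U (U.starProjection : SignalSpace T →ₗ[ℂ] SignalSpace T) :=
    ⟨fun x => Submodule.starProjection_apply_mem _ _,
      fun x hx => Submodule.starProjection_eq_self_iff.2 hx⟩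
  rw [h2, h3.trace, inner_self_eq_norm_sq_to_K] at h1
  exact (Complex.ofReal_injective (by simpa using h1)).symm

lemma procrustesDist_nonneg (U V : Submodule ℂ (SignalSpace T)) : 0 ≤ procrustesDist k U V :=
  Real.sqrt_nonneg _

lemma procrustesDist_eq_norm_sub {U V : Submodule ℂ (SignalSpace T)}
    (hU : U ∈ grassmannian T k) (hV : V ∈ grassmannian T k) :
    procrustesDist k U V = ‖projColumns U - projColumns V‖ / Real.sqrt 2 := by
  have hU' := norm_projColumns_sq U
  have hV' := norm_projColumns_sq V
  rw [show finrank ℂ U = k from hU] at hU'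
  rw [show finrank ℂ V = k from hV] at hV'
  have h := @norm_sub_sq ℂ _ _ _ _ (projColumns U) (projColumns V)
  rw [procrustesDist, trace_starProjection_comp, ← Real.sqrt_sq (norm_nonneg (_ - _)),
    ← Real.sqrt_div (sq_nonneg _), h, hU', hV']
  congr 1
  simp only [RCLike.re_to_complex]
  ring

lemma procrustesDist_triangle {U V V' : Submodule ℂ (SignalSpace T)}
    (hU : U ∈ grassmannian T k) (hV : V ∈ grassmannian T k) (hV' : V' ∈ grassmannian T k) :
    procrustesDist k V V' ≤ procrustesDist k U V + procrustesDist k U V' := by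
  rw [procrustesDist_eq_norm_sub hU hV, procrustesDist_eq_norm_sub hU hV',
    procrustesDist_eq_norm_sub hV hV', ← add_div]
  gcongr
  simpa only [dist_eq_norm] using
    dist_triangle_left (projColumns V) (projColumns V') (projColumns U)

lemma eq_of_procrustesDist_eq_zero {U V : Submodule ℂ (SignalSpace T)}
    (hU : U ∈ grassmannian T k) (hV : V ∈ grassmannian T k) (h : procrustesDist k U V = 0) :
    U = V := by
  rw [procrustesDist_eq_norm_sub hU hV, div_eq_zero_iff, norm_eq_zero, sub_eq_zero] at h
  have h := h.resolve_right (by positivity)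
  rw [← Submodule.starProjection_inj]
  have : (U.starProjection : SignalSpace T →ₗ[ℂ] SignalSpace T) = V.starProjection := by
    refine (EuclideanSpace.basisFun (Fin T) ℂ).toBasis.ext fun i => ?_
    have := congrArg (fun f : PiLp 2 (fun _ : Fin T => SignalSpace T) => f i) h
    simpa [projColumns] using this
  exact ContinuousLinearMap.coe_injective this

/-- The `j`-th column of a matrix. -/
noncomputable def column (A : Matrix (Fin T) (Fin k) ℂ) (j : Fin k) : SignalSpace T :=
  WithLp.toLp 2 fun i => A i j

lemma column_mem_colSpan (A : Matrix (Fin T) (Fin k) ℂ) (j : Fin k) : column A j ∈ colSpan A :=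
  Submodule.subset_span ⟨j, rfl⟩

lemma inner_column (A B : Matrix (Fin T) (Fin k) ℂ) (j l : Fin k) :
    inner ℂ (column A j) (column B l) = (Aᴴ * B) j l := by
  simp [column, PiLp.inner_apply, Matrix.mul_apply, mul_comm]

lemma orthonormal_column {A : Matrix (Fin T) (Fin k) ℂ} (hA : Aᴴ * A = 1) :
    Orthonormal ℂ (column A) := by
  rw [orthonormal_iff_ite]
  intro i j
  rw [inner_column, hA, Matrix.one_apply]

lemma colSpan_mem_grassmannian_of_linearIndependent {A : Matrix (Fin T) (Fin k) ℂ}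
    (hA : LinearIndependent ℂ (column A)) : colSpan A ∈ grassmannian T k := by
  exact (finrank_span_eq_card hA).trans (Fintype.card_fin k)

lemma colSpan_mem_grassmannian {A : Matrix (Fin T) (Fin k) ℂ} (hA : Aᴴ * A = 1) :
    colSpan A ∈ grassmannian T k :=
  colSpan_mem_grassmannian_of_linearIndependent (orthonormal_column hA).linearIndependent

/-- A linear relation between the columns of Z survives multiplication by Aᴴ. This reduces the rank
of the received matrix to one square determinant. -/
lemma colSpan_mem_grassmannian_of_det_ne_zero (A Z : Matrix (Fin T) (Fin k) ℂ)
    (h : (Aᴴ * Z).det ≠ 0) : colSpan Z ∈ grassmannian T k := by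
  refine colSpan_mem_grassmannian_of_linearIndependent ?_
  rw [Fintype.linearIndependent_iff]
  intro g hg
  have : (Aᴴ * Z) *ᵥ g = 0 := by
    ext j
    have h1 := congrArg (fun v => inner ℂ (column A j) v) hg
    simp only [inner_sum, inner_smul_right, inner_column, inner_zero_right] at h1
    simpa [Matrix.mulVec, dotProduct, mul_comm] using h1
  exact congrFun (Matrix.eq_zero_of_mulVec_eq_zero h this)

/-- Expanding P_A in rank-one projections turns the trace into a sum of squared residuals. U may
have any dimension, so the noise estimate needs no rank condition. -/
lemma procrustesDist_colSpan_sq (U : Submodule ℂ (SignalSpace T))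
    {A : Matrix (Fin T) (Fin k) ℂ} (hA : Aᴴ * A = 1) :
    procrustesDist k U (colSpan A) ^ 2 =
      ∑ j, ‖column A j - U.starProjection (column A j)‖ ^ 2 := by
  have hon := orthonormal_column hA
  have hspan : (Submodule.span ℂ (Set.range (column A))).starProjection =
      ∑ j, InnerProductSpace.rankOne ℂ (column A j) (column A j) := by
    have h : ⇑(Basis.span hon.linearIndependent) = fun j =>
        (⟨column A j, Submodule.subset_span (Set.mem_range_self j)⟩ :
          Submodule.span ℂ (Set.range (column A))) :=
      funext fun j => Basis.span_apply _ _
    let b := (Basis.span hon.linearIndependent).toOrthonormalBasis (h ▸ orthonormal_span hon)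
    have hb (j) : (b j : SignalSpace T) = column A j := by
      simp only [b, Basis.coe_toOrthonormalBasis, h]
    rw [b.starProjection_eq_sum_rankOne]
    simp only [hb]
  replace hspan : (colSpan A).starProjection = _ := hspan
  have htrace : LinearMap.trace ℂ (SignalSpace T)
      ((U.starProjection : SignalSpace T →ₗ[ℂ] SignalSpace T) ∘ₗ
        ((colSpan A).starProjection : SignalSpace T →ₗ[ℂ] SignalSpace T)) =
      ∑ j, inner ℂ (column A j) (U.starProjection (column A j)) := by
    rw [← ContinuousLinearMap.toLinearMap_comp, hspan]
    simp only [ContinuousLinearMap.comp_finsetSum, InnerProductSpace.comp_rankOne,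
      ContinuousLinearMap.toLinearMap_sum, map_sum, InnerProductSpace.trace_rankOne]
  have hterm (j) : ‖column A j - U.starProjection (column A j)‖ ^ 2 =
      1 - (inner ℂ (column A j) (U.starProjection (column A j))).re := by
    have h1 := @norm_sub_sq ℂ _ _ _ _ (column A j) (U.starProjection (column A j))
    have h2 : ‖U.starProjection (column A j)‖ ^ 2 =
        (inner ℂ (column A j) (U.starProjection (column A j))).re := by
      rw [← Submodule.starProjection_eq_self_iff.2
        (Submodule.starProjection_apply_mem U (column A j)),
        ← Submodule.inner_starProjection_left_eq_right,
        Submodule.starProjection_eq_self_iff.2 (Submodule.starProjection_apply_mem U (column A j))]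
      exact norm_sq_eq_re_inner (𝕜 := ℂ) _
    rw [h1, hon.1 j, h2, RCLike.re_to_complex]
    ring
  have hsum : ∑ j, ‖column A j - U.starProjection (column A j)‖ ^ 2 =
      (k : ℝ) - (∑ j, inner ℂ (column A j) (U.starProjection (column A j))).re := by
    simp [hterm, Complex.re_sum]
  rw [procrustesDist, htrace, ← hsum, Real.sq_sqrt (Finset.sum_nonneg fun _ _ => sq_nonneg _)]

lemma procrustesDist_receivedSymbol_sq_le (lam ρ : ℝ) {X : Matrix (Fin T) (Fin k) ℂ}
    (hX : Xᴴ * X = 1) (W : Matrix (Fin T) (Fin k) ℂ) :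
    procrustesDist k (receivedSymbol lam ρ X W) (colSpan X) ^ 2 ≤
      ((1 / lam) * Real.sqrt ((k : ℝ) / (ρ * (T : ℝ)))) ^ 2 *
        ∑ p : Fin T × Fin k, ‖W p.1 p.2‖ ^ 2 := by
  rw [procrustesDist_colSpan_sq _ hX, Fintype.sum_prod_type_right, Finset.mul_sum]
  refine Finset.sum_le_sum fun j _ => ?_
  set ε := (1 / lam) * Real.sqrt ((k : ℝ) / (ρ * (T : ℝ))) with hε
  have hmem := column_mem_colSpan (X + (ε : ℂ) • W) j
  -- The projection is the nearest point of the received subspace, and the noisy column is a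
  -- competitor in it.
  have hle : ‖column X j - (receivedSymbol lam ρ X W).starProjection (column X j)‖ ≤
      ‖column X j - column (X + (ε : ℂ) • W) j‖ := by
    rw [Submodule.starProjection_minimal]
    exact ciInf_le ⟨0, by rintro _ ⟨x, rfl⟩; positivity⟩
      (⟨_, hmem⟩ : receivedSymbol lam ρ X W)
  have heq : column X j - column (X + (ε : ℂ) • W) j = (-(ε : ℂ)) • column W j := by
    ext i
    simp [column]
  calc _ ≤ ‖column X j - column (X + (ε : ℂ) • W) j‖ ^ 2 := by gcongr
    _ = _ := by
      rw [heq, norm_smul, mul_pow, EuclideanSpace.norm_sq_eq]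
      simp [column]

lemma minDist_le {L : ℕ} (μ : Fin L → Matrix (Fin T) (Fin k) ℂ) {l m : Fin L} (h : l ≠ m) :
    minDist μ ≤ procrustesDist k (colSpan (μ l)) (colSpan (μ m)) :=
  csInf_le ⟨0, by rintro _ ⟨l, m, -, rfl⟩; exact procrustesDist_nonneg _ _⟩ ⟨l, m, h, rfl⟩

lemma minDist_pos {L : ℕ} (hL : 2 ≤ L) (μ : Fin L → Matrix (Fin T) (Fin k) ℂ)
    (hμ : ∀ l, (μ l)ᴴ * μ l = 1) (hinj : Function.Injective fun l => colSpan (μ l)) :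
    0 < minDist μ := by
  have hfin : {d : ℝ | ∃ l m : Fin L, l ≠ m ∧
      d = procrustesDist k (colSpan (μ l)) (colSpan (μ m))}.Finite :=
    (Set.finite_range fun p : Fin L × Fin L =>
      procrustesDist k (colSpan (μ p.1)) (colSpan (μ p.2))).subset (by
        rintro _ ⟨l, m, -, rfl⟩
        exact ⟨(l, m), rfl⟩)
  have hne : {d : ℝ | ∃ l m : Fin L, l ≠ m ∧
      d = procrustesDist k (colSpan (μ l)) (colSpan (μ m))}.Nonempty :=
    ⟨_, ⟨0, by omega⟩, ⟨1, by omega⟩, by simp, rfl⟩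
  obtain ⟨l, m, hlm, h⟩ := hne.csInf_mem hfin
  change minDist μ = _ at h
  refine lt_of_le_of_ne (h.symm ▸ procrustesDist_nonneg _ _) fun h0 => hlm (hinj ?_)
  exact eq_of_procrustesDist_eq_zero (colSpan_mem_grassmannian (hμ l))
    (colSpan_mem_grassmannian (hμ m)) (h.symm.trans h0.symm)

lemma mem_voronoiCell_of_lt {L : ℕ} (μ : Fin L → Matrix (Fin T) (Fin k) ℂ)
    (hμ : ∀ l, (μ l)ᴴ * μ l = 1) (l : Fin L) {U : Submodule ℂ (SignalSpace T)}
    (hU : U ∈ grassmannian T k) (h : procrustesDist k U (colSpan (μ l)) < minDist μ / 2) :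
    U ∈ voronoiCell μ l := by
  refine ⟨hU, fun m hm => ?_⟩
  have h1 := minDist_le μ hm.symm
  have h2 := procrustesDist_triangle hU (colSpan_mem_grassmannian (hμ l))
    (colSpan_mem_grassmannian (hμ m))
  linarith

/-- For k = 0 or k = T the Grassmannian is a single point and has no room for two codewords. Hence
D/2 ≥ 1. -/
lemma pos_and_lt_of_injective {L : ℕ} (hL : 2 ≤ L) (μ : Fin L → Matrix (Fin T) (Fin k) ℂ)
    (hμ : ∀ l, (μ l)ᴴ * μ l = 1) (hinj : Function.Injective fun l => colSpan (μ l)) :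
    0 < k ∧ k < T := by
  have h (l) : finrank ℂ (colSpan (μ l)) = k := colSpan_mem_grassmannian (hμ l)
  have hne : (⟨0, by omega⟩ : Fin L) ≠ ⟨1, by omega⟩ := by simp
  constructor
  · refine Nat.pos_of_ne_zero fun hk => hne (hinj ?_)
    subst hk
    simp only [Submodule.finrank_eq_zero.1 (h _)]
  · by_contra hk
    refine hne (hinj ?_)
    have hT : finrank ℂ (SignalSpace T) = T := by simp
    have htop (l) : colSpan (μ l) = ⊤ := by
      refine Submodule.eq_top_of_finrank_eq (le_antisymm (Submodule.finrank_le _) ?_)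
      rw [h, hT]
      omega
    simp only [htop]

end Geometry

/-! ### Gaussian noise: exponential moments and almost sure full rank -/

section ComplexGaussian

lemma measurable_mk_complex : Measurable fun p : ℝ × ℝ => (⟨p.1, p.2⟩ : ℂ) :=
  Complex.measurableEquivRealProd.symm.measurable

instance : IsProbabilityMeasure stdComplexGaussian :=
  Measure.isProbabilityMeasure_map measurable_mk_complex.aemeasurable

lemma stdComplexGaussian_absolutelyContinuous : stdComplexGaussian ≪ volume := by
  have h := (gaussianReal_absolutelyContinuous 0 (v := 1 / 2) (by simp)).prod
    (gaussianReal_absolutelyContinuous 0 (v := 1 / 2) (by simp))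
  have h' := h.map measurable_mk_complex
  rwa [show ((volume : Measure ℝ).prod volume).map (fun p : ℝ × ℝ => (⟨p.1, p.2⟩ : ℂ)) = volume
    from Complex.volume_preserving_equiv_real_prod.symm.map_eq] at h'

/-- With variance 1/2 the density is proportional to e^(-x²), whence the threshold 1. -/
lemma integrable_exp_mul_sq_gaussianReal {θ : ℝ} (hθ : θ < 1) :
    Integrable (fun x : ℝ => Real.exp (θ * x ^ 2)) (gaussianReal 0 (1 / 2 : ℝ≥0)) := by
  rw [gaussianReal_of_var_ne_zero _ (by simp), integrable_withDensity_iff_integrable_smul'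
    (measurable_gaussianPDF _ _) (.of_forall fun x => ENNReal.ofReal_lt_top)]
  refine ((integrable_exp_neg_mul_sq (sub_pos.2 hθ)).const_mul
    (Real.sqrt (2 * Real.pi * (1 / 2)))⁻¹).congr (.of_forall fun x => ?_)
  simp only [toReal_gaussianPDF, gaussianPDFReal, smul_eq_mul]
  push_cast
  rw [mul_assoc _ (Real.exp _), ← Real.exp_add, mul_assoc 2]
  congr 2
  ring

lemma integrable_exp_mul_norm_sq_stdComplexGaussian {θ : ℝ} (hθ : θ < 1) :
    Integrable (fun z : ℂ => Real.exp (θ * ‖z‖ ^ 2)) stdComplexGaussian := by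
  have hm : Measurable fun z : ℂ => Real.exp (θ * ‖z‖ ^ 2) := by fun_prop
  rw [stdComplexGaussian, integrable_map_measure hm.aestronglyMeasurable
    measurable_mk_complex.aemeasurable]
  refine ((integrable_exp_mul_sq_gaussianReal hθ).mul_prod
    (integrable_exp_mul_sq_gaussianReal hθ)).congr (.of_forall fun p => ?_)
  simp only [Function.comp_apply, Complex.sq_norm, Complex.normSq_apply, ← Real.exp_add]
  congr 1
  ring

variable {ι : Type*} [Fintype ι]

/-- The law of a finite family of independent `CN(0, 1)` variables. -/
noncomputable abbrev noiseLaw (ι : Type*) [Fintype ι] : Measure (ι → ℂ) :=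
  Measure.pi fun _ => stdComplexGaussian

lemma noiseLaw_tail_le {θ : ℝ} (hθ₀ : 0 ≤ θ) (hθ : θ < 1) (y : ℝ) :
    (noiseLaw ι).real {w | y ≤ ∑ p, ‖w p‖ ^ 2} ≤ Real.exp (-θ * y) *
      (∫ z, Real.exp (θ * ‖z‖ ^ 2) ∂stdComplexGaussian) ^ Fintype.card ι := by
  have heq (w : ι → ℂ) : Real.exp (θ * ∑ p, ‖w p‖ ^ 2) = ∏ p, Real.exp (θ * ‖w p‖ ^ 2) := by
    rw [Finset.mul_sum, Real.exp_sum]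
  have hint : Integrable (fun w : ι → ℂ => Real.exp (θ * ∑ p, ‖w p‖ ^ 2)) (noiseLaw ι) := by
    simp only [heq]
    exact Integrable.fintype_prod (f := fun (_ : ι) (z : ℂ) => Real.exp (θ * ‖z‖ ^ 2))
      fun _ => integrable_exp_mul_norm_sq_stdComplexGaussian hθ
  refine (measure_ge_le_exp_mul_mgf y hθ₀ hint).trans_eq ?_
  congr 1
  simp only [mgf, heq]
  exact integral_fintype_prod_eq_pow fun z : ℂ => Real.exp (θ * ‖z‖ ^ 2)

lemma absolutelyContinuous_pi_fin {α : Type*} [MeasurableSpace α] {μ ν : Measure α}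
    [SigmaFinite μ] [SigmaFinite ν] (h : μ ≪ ν) (n : ℕ) :
    (Measure.pi fun _ : Fin n => μ) ≪ Measure.pi fun _ : Fin n => ν := by
  induction n with
  | zero => rw [Measure.pi_of_empty (fun _ : Fin 0 => μ), Measure.pi_of_empty (fun _ : Fin 0 => ν)]
  | succ n ih =>
    have h1 := (measurePreserving_piFinSuccAbove (fun _ : Fin (n + 1) => μ) 0).symm
    have h2 := (measurePreserving_piFinSuccAbove (fun _ : Fin (n + 1) => ν) 0).symm
    rw [← h1.map_eq, ← h2.map_eq]
    exact (h.prod ih).map h1.measurable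

lemma absolutelyContinuous_pi {α : Type*} [MeasurableSpace α] {μ ν : Measure α}
    [SigmaFinite μ] [SigmaFinite ν] (h : μ ≪ ν) :
    (Measure.pi fun _ : ι => μ) ≪ Measure.pi fun _ : ι => ν := by
  have e := (Fintype.equivFin ι).symm
  have h1 := measurePreserving_piCongrLeft (α := fun _ => α) (fun _ : ι => μ) e
  have h2 := measurePreserving_piCongrLeft (α := fun _ => α) (fun _ : ι => ν) e
  rw [← h1.map_eq, ← h2.map_eq]
  exact (absolutelyContinuous_pi_fin h _).map h1.measurable

/-- On every real line in the direction X the determinant is a characteristic polynomial in the line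
parameter, so it vanishes at finitely many points. A Fubini argument makes the zero set Lebesgue
null, and the noise law is absolutely continuous. -/
lemma ae_det_add_smul_ne_zero {T k : ℕ} (X : Matrix (Fin T) (Fin k) ℂ) (hX : Xᴴ * X = 1)
    {ε : ℝ} (hε : ε ≠ 0) :
    ∀ᵐ w ∂noiseLaw (Fin T × Fin k),
      (Xᴴ * (X + (ε : ℂ) • Matrix.of fun i j => w (i, j))).det ≠ 0 := by
  refine (absolutelyContinuous_pi stdComplexGaussian_absolutelyContinuous).ae_le ?_
  have hs : MeasurableSet {w : Fin T × Fin k → ℂ |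
      (Xᴴ * (X + (ε : ℂ) • Matrix.of fun i j => w (i, j))).det ≠ 0} := by
    have hc : Continuous fun w : Fin T × Fin k → ℂ =>
        (Xᴴ * (X + (ε : ℂ) • Matrix.of fun i j => w (i, j))).det := by
      refine Continuous.matrix_det (continuous_const.matrix_mul (continuous_const.add
        (continuous_const_smul (ε : ℂ) |>.comp ?_)))
      exact continuous_matrix fun i j => continuous_apply (i, j)
    exact (isOpen_ne_fun hc continuous_const).measurableSet
  let D : ℝ →ₗ[ℝ] (Fin T × Fin k → ℂ) :=
    LinearMap.toSpanSingleton ℝ _ fun p => X p.1 p.2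
  refine ae_mem_of_ae_add_linearMap_mem D volume volume hs fun w => ?_
  set M : Matrix (Fin k) (Fin k) ℂ := Xᴴ * (X + (ε : ℂ) • Matrix.of fun i j => w (i, j))
  have hline (t : ℝ) : Xᴴ * (X + (ε : ℂ) • Matrix.of fun i j => (w + D t) (i, j)) =
      Matrix.scalar _ ((ε : ℂ) * t) - -M := by
    have h1 : (Matrix.of fun i j => (w + D t) (i, j)) =
        (Matrix.of fun i j => w (i, j)) + (t : ℂ) • X := by
      ext i j
      simp [D]
    rw [h1, smul_add, ← add_assoc, Matrix.mul_add, smul_smul, Matrix.mul_smul, hX,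
      Matrix.smul_one_eq_diagonal, sub_neg_eq_add, add_comm]
    rfl
  have hfin : {t : ℝ | (-M).charpoly.IsRoot ((ε : ℂ) * t)}.Finite := by
    refine ((-M).charpoly.rootSet_finite ℂ).preimage (f := fun t : ℝ => (ε : ℂ) * t) ?_ |>.subset ?_
    · intro a _ b _ hab
      simpa [hε] using hab
    · intro t ht
      exact (Polynomial.mem_rootSet_of_ne (Matrix.charpoly_monic _).ne_zero).2 (by simpa using ht)
  refine measure_mono_null (fun t ht => ?_) (hfin.measure_zero volume)
  by_contra hroot
  refine ht ?_
  change (Xᴴ * (X + (ε : ℂ) • Matrix.of fun i j => (w + D t) (i, j))).det ≠ 0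
  rw [hline, ← Matrix.eval_charpoly]
  exact hroot

end ComplexGaussian

/-! ### The lower bound as a function of ρ and its expansion -/

section IncompleteGamma

lemma lowerGamma_natCast_succ (n : ℕ) (x : ℝ) :
    lowerGamma ((n : ℝ) + 1) x = n.factorial *
      (1 - Real.exp (-x) * ∑ m ∈ Finset.range (n + 1), x ^ m / m.factorial) := by
  have hderiv (t : ℝ) : HasDerivAt (fun t : ℝ => -((n.factorial : ℝ) *
      (Real.exp (-t) * ∑ m ∈ Finset.range (n + 1), t ^ m / m.factorial)))
      (t ^ n * Real.exp (-t)) t := by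
    -- Differentiating the truncated exponential drops its top term, so the product with e^(-t) has
    -- a one-term derivative.
    have hpoly : ∀ j : ℕ, HasDerivAt
        (fun t : ℝ => ∑ m ∈ Finset.range (j + 1), t ^ m / (m.factorial : ℝ))
        ((∑ m ∈ Finset.range (j + 1), t ^ m / (m.factorial : ℝ)) - t ^ j / j.factorial) t := by
      intro j
      induction j with
      | zero => simpa using hasDerivAt_const t (1 : ℝ)
      | succ j ih =>
        have h := ih.add ((hasDerivAt_pow (j + 1) t).div_const ((j + 1).factorial : ℝ))
        refine (h.congr_of_eventuallyEq (.of_forall fun y => ?_)).congr_deriv ?_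
        · simp [Finset.sum_range_succ]
        · rw [Finset.sum_range_succ _ (j + 1), Nat.factorial_succ]
          push_cast
          have h1 : (j.factorial : ℝ) ≠ 0 := by positivity
          have h2 : (j : ℝ) + 1 ≠ 0 := by positivity
          field_simp
          ring
    have h := (((hasDerivAt_neg t).exp.mul (hpoly n)).const_mul (n.factorial : ℝ)).neg
    refine h.congr_deriv ?_
    have h1 : (n.factorial : ℝ) ≠ 0 := by positivity
    field_simp
    ring
  have hint : lowerGamma ((n : ℝ) + 1) x = ∫ t in (0 : ℝ)..x, t ^ n * Real.exp (-t) := by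
    simp [lowerGamma]
  rw [hint, intervalIntegral.integral_eq_sub_of_hasDerivAt (fun t _ => hderiv t)
    (Continuous.intervalIntegrable (by fun_prop) _ _)]
  simp [Finset.sum_range_succ']
  ring

variable (T k : ℕ) (lam d ρ : ℝ)

lemma grassDim_div_two : grassDim T k / 2 = k * (T - k) := by
  rw [grassDim, mul_assoc, Nat.mul_div_cancel_left _ two_pos]

lemma eval_polyG : (polyG T k lam d).eval ρ =
    ∑ m ∈ Finset.range (k * (T - k)), (rate T k lam d * ρ) ^ m / m.factorial := by
  rw [polyG, grassDim_div_two, Polynomial.eval_finsetSum]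
  refine Finset.sum_congr rfl fun m _ => ?_
  simp only [Polynomial.eval_mul, Polynomial.eval_C, Polynomial.eval_pow, Polynomial.eval_X, rate]
  rw [mul_pow _ ρ, div_pow]
  ring

lemma sepBound_eq_pow {k T : ℕ} (hk : 0 < k) (hT : k < T) (N : ℕ) :
    sepBound T k N lam d ρ =
      (1 - Real.exp (-(rate T k lam d * ρ)) * (polyG T k lam d).eval ρ) ^ N := by
  obtain ⟨n, hn⟩ : ∃ n, k * (T - k) = n + 1 :=
    Nat.exists_eq_succ_of_ne_zero (Nat.mul_pos hk (Nat.sub_pos_of_lt hT)).ne'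
  have hD : (grassDim T k : ℝ) / 2 = (n : ℝ) + 1 := by
    have : grassDim T k = 2 * (n + 1) := by rw [grassDim, mul_assoc, hn]
    rw [this]
    push_cast
    ring
  have hx : ρ * (T : ℝ) * lam ^ 2 * d ^ 2 / (8 * (k : ℝ)) = rate T k lam d * ρ := by
    rw [rate]
    ring
  rw [sepBound, hD, hx, lowerGamma_natCast_succ, Real.Gamma_nat_eq_factorial, eval_polyG, hn,
    ← mul_assoc, one_div_mul_cancel (by positivity), one_mul]

lemma rate_nonneg : 0 ≤ rate T k lam d := by
  unfold rate
  positivity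

variable {ρ} in
lemma exp_mul_polyG_mem_Icc (hρ : 0 ≤ ρ) :
    Real.exp (-(rate T k lam d * ρ)) * (polyG T k lam d).eval ρ ∈ Set.Icc 0 1 := by
  have hx : 0 ≤ rate T k lam d * ρ := mul_nonneg (rate_nonneg _ _ _ _) hρ
  rw [eval_polyG]
  refine ⟨by positivity, ?_⟩
  calc _ ≤ Real.exp (-(rate T k lam d * ρ)) * Real.exp (rate T k lam d * ρ) := by
        gcongr
        exact Real.sum_le_exp_of_nonneg hx _
    _ = 1 := by rw [← Real.exp_add]; simp

variable {ρ} in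
-- Only the term m = 0 of G_m and one of the N factors are kept; the exponential rate c is
-- unaffected.
lemma sepBound_le {k T : ℕ} (hk : 0 < k) (hT : k < T) {N : ℕ} (hN : 1 ≤ N) (hρ : 0 ≤ ρ) :
    sepBound T k N lam d ρ ≤ 1 - Real.exp (-(rate T k lam d * ρ)) := by
  have h := exp_mul_polyG_mem_Icc T k lam d hρ
  have hG : 1 ≤ (polyG T k lam d).eval ρ := by
    have hx : 0 ≤ rate T k lam d * ρ := mul_nonneg (rate_nonneg _ _ _ _) hρ
    rw [eval_polyG]
    have h0 : 0 ∈ Finset.range (k * (T - k)) :=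
      Finset.mem_range.2 (Nat.mul_pos hk (Nat.sub_pos_of_lt hT))
    simpa using Finset.single_le_sum (f := fun m : ℕ =>
      (rate T k lam d * ρ) ^ m / (m.factorial : ℝ)) (fun _ _ => by positivity) h0
  rw [sepBound_eq_pow lam d ρ hk hT]
  calc _ ≤ 1 - Real.exp (-(rate T k lam d * ρ)) * (polyG T k lam d).eval ρ :=
        pow_le_of_le_one (by linarith [h.2]) (by linarith [h.1]) (by omega)
    _ ≤ _ := by
        have := le_mul_of_one_le_right (Real.exp_nonneg (-(rate T k lam d * ρ))) hG
        linarith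

lemma abs_one_sub_pow_sub_le {u : ℝ} (hu : u ∈ Set.Icc 0 1) (N : ℕ) :
    |(1 - u) ^ N - (1 - N * u)| ≤ (N : ℝ) ^ 2 * u ^ 2 := by
  obtain ⟨h0, h1⟩ := hu
  suffices h : 0 ≤ (1 - u) ^ N - (1 - N * u) ∧ (1 - u) ^ N - (1 - N * u) ≤ (N : ℝ) ^ 2 * u ^ 2 by
    rw [abs_of_nonneg h.1]
    exact h.2
  induction N with
  | zero => simp
  | succ N ih =>
    -- This recursion carries both bounds: the error grows by at most N u², and N² + N ≤ (N + 1)².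
    have e : (1 - u) ^ (N + 1) - (1 - ((N + 1 : ℕ) : ℝ) * u) =
        N * u ^ 2 + (1 - u) * ((1 - u) ^ N - (1 - N * u)) := by
      push_cast
      ring
    rw [e]
    have h3 : 0 ≤ (1 - u) * ((1 - u) ^ N - (1 - N * u)) := mul_nonneg (by linarith) ih.1
    have h4 : (1 - u) * ((1 - u) ^ N - (1 - N * u)) ≤ (1 - u) ^ N - (1 - N * u) :=
      mul_le_of_le_one_left ih.1 (by linarith)
    refine ⟨by positivity, ?_⟩
    push_cast
    nlinarith [ih.2, mul_nonneg (Nat.cast_nonneg (α := ℝ) N) (sq_nonneg u), sq_nonneg u]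

lemma expansionError_isBigO {k T : ℕ} (hk : 0 < k) (hT : k < T) (N : ℕ) :
    expansionError T k N lam d =O[atTop] fun ρ : ℝ =>
      (Real.exp (-(rate T k lam d * ρ)) * (polyG T k lam d).eval ρ) ^ 2 := by
  refine IsBigO.of_bound ((N : ℝ) ^ 2) ?_
  filter_upwards [eventually_ge_atTop 0] with ρ hρ
  have hx : ρ * (T : ℝ) * lam ^ 2 * d ^ 2 / (8 * (k : ℝ)) = rate T k lam d * ρ := by
    rw [rate]
    ring
  have h := abs_one_sub_pow_sub_le (exp_mul_polyG_mem_Icc T k lam d hρ) N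
  rw [Real.norm_eq_abs, norm_pow, Real.norm_eq_abs, sq_abs, expansionError,
    sepBound_eq_pow lam d ρ hk hT, hx, mul_assoc]
  exact h

variable {lam d} in
lemma sq_exp_mul_polyG_isBigO (hc : 1 < rate T k lam d) :
    (fun ρ : ℝ => (Real.exp (-(rate T k lam d * ρ)) * (polyG T k lam d).eval ρ) ^ 2) =O[atTop]
      fun ρ : ℝ => Real.exp (-(2 * ρ)) := by
  -- The surplus c - 1 > 0 in the rate absorbs the polynomial, leaving e^(-ρ) before squaring.
  have hpoly : (fun ρ : ℝ => (polyG T k lam d).eval ρ) =O[atTop]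
      fun ρ : ℝ => Real.exp ((rate T k lam d - 1) * ρ) := by
    simp only [eval_polyG, mul_pow, mul_div_right_comm]
    exact IsBigO.fun_sum fun m _ =>
      ((isLittleO_pow_exp_pos_mul_atTop m (sub_pos.2 hc)).isBigO.const_mul_left _)
  have h := ((isBigO_refl (fun ρ : ℝ => Real.exp (-(rate T k lam d * ρ))) atTop).mul hpoly).pow 2
  refine h.congr_right fun ρ => ?_
  rw [← Real.exp_add, ← Real.exp_nat_mul]
  congr 1
  push_cast
  ring

end IncompleteGamma

/-! ### From the noise tail to the separability probability -/

section SeparabilityBound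

variable {Ω : Type*} [MeasurableSpace Ω] {P : Measure Ω} {T k L : ℕ}

lemma cond_real_preimage_of_indepFun [IsProbabilityMeasure P] {α β : Type*}
    [MeasurableSpace α] [MeasurableSpace β]
    {s : Ω → α} {V : Ω → β} (h : IndepFun s V P) (hs : Measurable s) {A : Set α} {B : Set β}
    (hA : MeasurableSet A) (hB : MeasurableSet B) (hpos : P (s ⁻¹' A) ≠ 0) :
    (ProbabilityTheory.cond P (s ⁻¹' A)).real (V ⁻¹' B) = P.real (V ⁻¹' B) := by
  rw [measureReal_def, measureReal_def, cond_apply (hs hA),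
    h.measure_inter_preimage_eq_mul A B hA hB, ← mul_assoc,
    ENNReal.inv_mul_cancel hpos (measure_ne_top _ _), one_mul]

lemma ae_receivedSymbol_mem_grassmannian {μ : Fin L → Matrix (Fin T) (Fin k) ℂ}
    (hμ : ∀ l, (μ l)ᴴ * μ l = 1) (s : Ω → Fin L) {W : Ω → Matrix (Fin T) (Fin k) ℂ}
    (hV : HasLaw (fun ω (p : Fin T × Fin k) => W ω p.1 p.2) (noiseLaw (Fin T × Fin k)) P)
    {lam ρ : ℝ} (hlam : 0 < lam) (hρ : 0 < ρ) (hk : 0 < k) (hT : 0 < T) :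
    ∀ᵐ ω ∂P, receivedSymbol lam ρ (μ (s ω)) (W ω) ∈ grassmannian T k := by
  have hε : (1 / lam) * Real.sqrt ((k : ℝ) / (ρ * (T : ℝ))) ≠ 0 := by positivity
  have hall : ∀ᵐ ω ∂P, ∀ l, receivedSymbol lam ρ (μ l) (W ω) ∈ grassmannian T k := by
    refine ae_all_iff.2 fun l => ?_
    have h := ae_det_add_smul_ne_zero (μ l) (hμ l) hε
    rw [← hV.map_eq] at h
    filter_upwards [ae_of_ae_map hV.aemeasurable h] with ω hω
    exact colSpan_mem_grassmannian_of_det_ne_zero _ _ hω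
  filter_upwards [hall] with ω hω using hω _

/-- Small noise forces a small distance for the model symbol; the equal distance laws transfer this
to Υ, and a small distance means the right cell. Υ need not be measurable: these comparisons use
only monotonicity of outer measure, and measurability matters only for the events in s and W. -/
lemma one_sub_noise_tail_le_cond_voronoiCell [IsProbabilityMeasure P]
    {μ : Fin L → Matrix (Fin T) (Fin k) ℂ}
    (hμ : ∀ l, (μ l)ᴴ * μ l = 1) {s : Ω → Fin L} (hs : Measurable s)
    (hs_pos : ∀ l, P (s ⁻¹' {l}) ≠ 0) {W : Ω → Matrix (Fin T) (Fin k) ℂ}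
    (hV : HasLaw (fun ω (p : Fin T × Fin k) => W ω p.1 p.2) (noiseLaw (Fin T × Fin k)) P)
    (hsW : IndepFun s (fun ω (p : Fin T × Fin k) => W ω p.1 p.2) P)
    {lam ρ : ℝ} {Υ : Ω → Submodule ℂ (SignalSpace T)}
    (hΥ : ∀ᵐ ω ∂P, Υ ω ∈ grassmannian T k)
    (hlaw : SameDistanceLaw P μ s Υ fun ω => receivedSymbol lam ρ (μ (s ω)) (W ω))
    {r y : ℝ} (hr₀ : 0 ≤ r) (hr : r < minDist μ / 2)
    (hy : ((1 / lam) * Real.sqrt ((k : ℝ) / (ρ * (T : ℝ)))) ^ 2 * y ≤ r ^ 2) (l : Fin L) :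
    1 - (noiseLaw (Fin T × Fin k)).real {w | y ≤ ∑ p, ‖w p‖ ^ 2} ≤
      (ProbabilityTheory.cond P (s ⁻¹' {l})).real {ω | Υ ω ∈ voronoiCell μ l} := by
  set Q := ProbabilityTheory.cond P (s ⁻¹' {l}) with hQ
  have hQP : Q ≪ P := cond_absolutelyContinuous
  have : IsProbabilityMeasure Q := cond_isProbabilityMeasure (hs_pos l)
  have hB : MeasurableSet {w : Fin T × Fin k → ℂ | ∑ p, ‖w p‖ ^ 2 ≤ y} :=
    measurableSet_le (by fun_prop) measurable_const
  have h1 : Q {ω | procrustesDist k (Υ ω) (colSpan (μ l)) ≤ r} ≤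
      Q {ω | Υ ω ∈ voronoiCell μ l} := by
    refine measure_mono_ae ?_
    filter_upwards [hQP.ae_le hΥ] with ω hω hle
    exact mem_voronoiCell_of_lt μ hμ l hω (lt_of_le_of_lt hle hr)
  have h2 : Q ((fun ω (p : Fin T × Fin k) => W ω p.1 p.2) ⁻¹' {w | ∑ p, ‖w p‖ ^ 2 ≤ y}) ≤
      Q {ω | procrustesDist k (receivedSymbol lam ρ (μ (s ω)) (W ω)) (colSpan (μ l)) ≤ r} := by
    refine measure_mono_ae ?_
    filter_upwards [ae_cond_mem (μ := P) (hs (measurableSet_singleton l))] with ω hω hle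
    change ∑ p : Fin T × Fin k, ‖W ω p.1 p.2‖ ^ 2 ≤ y at hle
    change procrustesDist k (receivedSymbol lam ρ (μ (s ω)) (W ω)) (colSpan (μ l)) ≤ r
    rw [show s ω = l from hω]
    refine abs_le_of_sq_le_sq' ?_ hr₀ |>.2
    exact ((procrustesDist_receivedSymbol_sq_le lam ρ (hμ l) (W ω)).trans
      (mul_le_mul_of_nonneg_left hle (sq_nonneg _))).trans hy
  have h3 : (noiseLaw (Fin T × Fin k)).real {w | ∑ p, ‖w p‖ ^ 2 ≤ y} =
      Q.real ((fun ω (p : Fin T × Fin k) => W ω p.1 p.2) ⁻¹' {w | ∑ p, ‖w p‖ ^ 2 ≤ y}) := by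
    rw [hQ, cond_real_preimage_of_indepFun hsW hs (measurableSet_singleton l) hB (hs_pos l),
      ← hV.map_eq, map_measureReal_apply_of_aemeasurable hV.aemeasurable hB]
  calc _ ≤ (noiseLaw (Fin T × Fin k)).real {w | ∑ p, ‖w p‖ ^ 2 ≤ y} := by
        rw [sub_le_comm, ← probReal_compl_eq_one_sub hB]
        exact measureReal_mono fun w (hw : ¬ ∑ p, ‖w p‖ ^ 2 ≤ y) => (not_le.1 hw).le
    _ ≤ _ := by
        rw [h3]
        exact ENNReal.toReal_mono (measure_ne_top _ _) (h2.trans ((hlaw l r).symm.le.trans h1))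

lemma eventually_sepBound_le_sepProb [IsProbabilityMeasure P] (hL : 2 ≤ L) {N : ℕ} (hN : 1 ≤ N)
    {lam : ℝ} (hlam : 0 < lam)
    {μ : Fin L → Matrix (Fin T) (Fin k) ℂ} (hμ : ∀ l, (μ l)ᴴ * μ l = 1)
    (hinj : Function.Injective fun l => colSpan (μ l)) {s : Ω → Fin L} (hs : Measurable s)
    (hs_pos : ∀ l, P (s ⁻¹' {l}) ≠ 0) {W : Ω → Matrix (Fin T) (Fin k) ℂ}
    (hV : HasLaw (fun ω (p : Fin T × Fin k) => W ω p.1 p.2) (noiseLaw (Fin T × Fin k)) P)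
    (hsW : IndepFun s (fun ω (p : Fin T × Fin k) => W ω p.1 p.2) P)
    (Υ : ℝ → Ω → Submodule ℂ (SignalSpace T))
    (hΥ : ∀ ρ : ℝ, 0 < ρ → ∀ᵐ ω ∂P, Υ ρ ω ∈ grassmannian T k)
    (hlaw : ∀ ρ : ℝ, 0 < ρ →
      SameDistanceLaw P μ s (Υ ρ) fun ω => receivedSymbol lam ρ (μ (s ω)) (W ω)) :
    ∀ᶠ ρ : ℝ in atTop, sepBound T k N lam (minDist μ) ρ ≤ sepProb P μ s (Υ ρ) := by
  obtain ⟨hk, hkT⟩ := pos_and_lt_of_injective hL μ hμ hinj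
  have hd := minDist_pos hL μ hμ hinj
  have hT : 0 < T := hk.trans hkT
  set d := minDist μ with hd_def
  set c := rate T k lam d with hc_def
  have hc : 0 < c := by
    rw [hc_def, rate]
    positivity
  -- The Chernoff prefactor at θ = 5/6 does not depend on ρ, so any surplus exponential decay
  -- removes it.
  set M := (∫ z, Real.exp (5 / 6 * ‖z‖ ^ 2) ∂stdComplexGaussian) ^
    Fintype.card (Fin T × Fin k) with hM
  have hlim : Tendsto (fun ρ : ℝ => Real.exp (-(7 / 20 * c * ρ)) * M) atTop (𝓝 0) := by
    have h : Tendsto (fun ρ : ℝ => 7 / 20 * c * ρ) atTop atTop :=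
      tendsto_id.const_mul_atTop (by positivity)
    simpa using (Real.tendsto_exp_neg_atTop_nhds_zero.comp h).mul_const M
  filter_upwards [eventually_gt_atTop 0, hlim.eventually_le_const one_pos] with ρ hρ hsmall
  -- The radius 9d/20 is strictly below d/2. Since d²/ε² = 8cρ, it corresponds to the noise level
  -- (9/20)² · 8cρ = (81/50)cρ.
  have hy : ((1 / lam) * Real.sqrt ((k : ℝ) / (ρ * (T : ℝ)))) ^ 2 * (81 / 50 * (c * ρ)) ≤
      (9 / 20 * d) ^ 2 := by
    refine le_of_eq ?_
    rw [mul_pow, Real.sq_sqrt (by positivity), hc_def, rate]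
    field_simp
    ring
  have htail : (noiseLaw (Fin T × Fin k)).real {w | 81 / 50 * (c * ρ) ≤ ∑ p, ‖w p‖ ^ 2} ≤
      Real.exp (-(c * ρ)) := by
    refine (noiseLaw_tail_le (θ := 5 / 6) (by norm_num) (by norm_num) _).trans ?_
    -- The product (5/6)(81/50) = 27/20 exceeds 1; the excess 7/20 pays for `M`.
    rw [← hM, show -(5 / 6) * (81 / 50 * (c * ρ)) = -(c * ρ) + -(7 / 20 * c * ρ) by ring,
      Real.exp_add, mul_assoc]
    exact mul_le_of_le_one_right (Real.exp_nonneg _) hsmall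
  refine (sepBound_le lam d hk hkT hN hρ.le).trans ?_
  have hcell (l : Fin L) : 1 - Real.exp (-(c * ρ)) ≤
      (ProbabilityTheory.cond P (s ⁻¹' {l})).real {ω | Υ ρ ω ∈ voronoiCell μ l} :=
    (sub_le_sub_left htail 1).trans (one_sub_noise_tail_le_cond_voronoiCell hμ hs hs_pos hV hsW
      (hΥ ρ hρ) (hlaw ρ hρ) (by positivity) (by linarith) hy l)
  have hsum := Finset.sum_le_sum fun l (_ : l ∈ Finset.univ) => hcell l
  rw [Finset.sum_const, Finset.card_univ, Fintype.card_fin, nsmul_eq_mul] at hsum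
  have hL' : (0 : ℝ) < L := by exact_mod_cast (by omega : 0 < L)
  rw [sepProb, one_div, ← div_eq_inv_mul, le_div_iff₀' hL']
  exact hsum

end SeparabilityBound

end GrassmannKMeans

theorem theorem1 {Ω : Type*} [MeasurableSpace Ω] (P : Measure Ω) [IsProbabilityMeasure P]
    (T Nt L N : ℕ) (hL : 2 ≤ L) (hN : 1 ≤ N) (lam : ℝ) (hlam : 0 < lam)
    (μ : Fin L → Matrix (Fin T) (Fin Nt) ℂ)
    (hμ : ∀ l, (μ l)ᴴ * μ l = 1)
    (hμ_inj : Function.Injective fun l => GrassmannKMeans.colSpan (μ l))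
    (s : Ω → Fin L) (hs : Measurable s) (hs_pos : ∀ l, P (s ⁻¹' {l}) ≠ 0)
    (W : Ω → Matrix (Fin T) (Fin Nt) ℂ)
    (hW_law : ∀ i j, HasLaw (fun ω => W ω i j) GrassmannKMeans.stdComplexGaussian P)
    (hW_indep : iIndepFun (fun (p : Fin T × Fin Nt) (ω : Ω) => W ω p.1 p.2) P)
    (hsW : IndepFun s (fun (ω : Ω) (p : Fin T × Fin Nt) => W ω p.1 p.2) P) :
    (∀ᶠ ρ : ℝ in atTop,
      GrassmannKMeans.sepBound T Nt N lam (GrassmannKMeans.minDist μ) ρ ≤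
        GrassmannKMeans.sepProb P μ s
          (fun ω => GrassmannKMeans.receivedSymbol lam ρ (μ (s ω)) (W ω))) ∧
    (∀ Υ : ℝ → Ω → Submodule ℂ (GrassmannKMeans.SignalSpace T),
      (∀ ρ : ℝ, 0 < ρ → ∀ᵐ ω ∂P, Υ ρ ω ∈ GrassmannKMeans.grassmannian T Nt) →
      (∀ ρ : ℝ, 0 < ρ → GrassmannKMeans.SameDistanceLaw P μ s (Υ ρ)
          (fun ω => GrassmannKMeans.receivedSymbol lam ρ (μ (s ω)) (W ω))) →
      ∀ᶠ ρ : ℝ in atTop,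
        GrassmannKMeans.sepBound T Nt N lam (GrassmannKMeans.minDist μ) ρ ≤
          GrassmannKMeans.sepProb P μ s (Υ ρ)) ∧
    (GrassmannKMeans.expansionError T Nt N lam (GrassmannKMeans.minDist μ)) =O[atTop]
      (fun ρ : ℝ =>
        (Real.exp (-(GrassmannKMeans.rate T Nt lam (GrassmannKMeans.minDist μ) * ρ)) *
          (GrassmannKMeans.polyG T Nt lam (GrassmannKMeans.minDist μ)).eval ρ) ^ 2) ∧
    (1 < GrassmannKMeans.rate T Nt lam (GrassmannKMeans.minDist μ) →
      (GrassmannKMeans.expansionError T Nt N lam (GrassmannKMeans.minDist μ)) =O[atTop]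
        (fun ρ : ℝ => Real.exp (-(2 * ρ)))) := by
  obtain ⟨hk, hkT⟩ := GrassmannKMeans.pos_and_lt_of_injective hL μ hμ hμ_inj
  have hV : HasLaw (fun ω (p : Fin T × Fin Nt) => W ω p.1 p.2)
      (GrassmannKMeans.noiseLaw (Fin T × Fin Nt)) P :=
    hW_indep.hasLaw_pi fun p => hW_law p.1 p.2
  have hbound := GrassmannKMeans.eventually_sepBound_le_sepProb hL hN hlam hμ hμ_inj hs hs_pos
    hV hsW
  refine ⟨hbound _ (fun ρ hρ => GrassmannKMeans.ae_receivedSymbol_mem_grassmannian hμ s hV hlam hρ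
    hk (hk.trans hkT)) fun ρ _ l r => rfl, hbound,
    GrassmannKMeans.expansionError_isBigO _ _ hk hkT N, fun hc => ?_⟩
  exact (GrassmannKMeans.expansionError_isBigO _ _ hk hkT N).trans
    (GrassmannKMeans.sq_exp_mul_polyG_isBigO T Nt hc)
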